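/- **Theorem 2.1.** Let $\mu$ be a probability measure on $\mathbb{R}$ with compact support $\mathrm{Supp}(\mu)\subset[a,b]$, where $b-a>1$ and $\{a,b\}\subset\mathrm{Supp}(\mu)$. Assume that for each $n\ge 1$ there are integers $x^{(n)}_1>x^{(n)}_2>\cdots>x^{(n)}_n$ such that $\frac1n\sum_{i=1}^n\delta_{x^{(n)}_i/n}\to\mu$ weakly as $n\to\infty$. Let $$C(w):=\int_a^b\frac{\mu[dx]}{w-x}\qquad(w\in\mathbb{C}\setminus\mathbb{R})$$ be the Cauchy transform of $\mu$ and, for real $\chi,\eta$, let $$f_{(\chi,\eta)}'(w):=C(w)+\log(w-\chi)-\log(w-\chi-\eta+1)\qquad(w\in\mathbb{C}\setminus\mathbb{R}),$$ with principal logarithms. Let the liquid region $\mathcal{L}$ be the set of all $(\chi,\eta)\in[a,b]\times[0,1]$ with $b\ge\chi\ge\chi+\eta-1\ge a$ for which $f_{(\chi,\eta)}'$ has a root in $\mathbb{C}\setminus\mathbb{R}$, and let $\mathbb{H}:=\{w\in\mathbb{C}:\mathrm{Im}(w)>0\}$. Then: 1. For every $(\chi,\eta)\in\mathcal{L}$ the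 function $f_{(\chi,\eta)}'$ has exactly one root in $\mathbb{H}$; denote it by $W_{\mathcal{L}}(\chi,\eta)$. 2. $W_{\mathcal{L}}:\mathcal{L}\to\mathbb{H}$ is a homeomorphism of $\mathcal{L}$ onto $\mathbb{H}$. Its inverse is $w\mapsto(\chi_{\mathcal{L}}(w),\eta_{\mathcal{L}}(w))$, where, for all $w\in\mathbb{H}$, $$\chi_{\mathcal{L}}(w)=w+\frac{(w-\bar w)(e^{C(\bar w)}-1)}{e^{C(w)}-e^{C(\bar w)}},\qquad \eta_{\mathcal{L}}(w)=1+\frac{(w-\bar w)(e^{C(w)}-1)(e^{C(\bar w)}-1)}{e^{C(w)}-e^{C(\bar w)}};$$ in particular the denominator $e^{C(w)}-e^{C(\bar w)}$ does not vanish and both expressions are real. 3. Consequently $\mathcal{L}$ is a non-empty, open and connected subset of $\mathbb{R}^2$. -/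

import Mathlib

open MeasureTheory Filter Topology UpperHalfPlane ComplexConjugate
open scoped NNReal

noncomputable section

namespace LiquidRegion

/-- The rescaled empirical measure `(1/n) ∑_{i=1}^n δ_{x_i / n}` of `n` integer points
(the zero measure in the irrelevant case `n = 0`). -/
def empiricalMeasure (n : ℕ) (x : Fin n → ℤ) : FiniteMeasure ℝ :=
  ((n : ℝ≥0)⁻¹) • ∑ i, (diracProba ((x i : ℝ) / (n : ℝ))).toFiniteMeasure

/-- The standing assumption: `Supp μ ⊆ [a, b]`, `b - a > 1`, `{a, b} ⊆ Supp μ`, and `μ` is the weak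
limit of the rescaled empirical measures of strictly decreasing integer vectors `x⁽ⁿ⁾ ∈ ℤⁿ`. -/
structure Admissible (μ : ProbabilityMeasure ℝ) (a b : ℝ) (x : (n : ℕ) → Fin n → ℤ) : Prop where
  support_subset : (μ : Measure ℝ).support ⊆ Set.Icc a b
  one_lt : 1 < b - a
  left_mem : a ∈ (μ : Measure ℝ).support
  right_mem : b ∈ (μ : Measure ℝ).support
  strictAnti : ∀ n, StrictAnti (x n)
  weak_limit : Tendsto (fun n => empiricalMeasure n (x n)) atTop (𝓝 μ.toFiniteMeasure)

/-- The Cauchy transform `C(w) = ∫ μ(dx) / (w - x)`, used for non-real `w`. -/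
def cauchyTransform (μ : ProbabilityMeasure ℝ) (w : ℂ) : ℂ :=
  ∫ x : ℝ, 1 / (w - (x : ℂ)) ∂(μ : Measure ℝ)

/-- `f'_{(χ,η)}(w) = C(w) + log (w - χ) - log (w - χ - η + 1)` with the principal logarithm,
for `p = (χ, η)`, used for non-real `w`. -/
def fDeriv (μ : ProbabilityMeasure ℝ) (p : ℝ × ℝ) (w : ℂ) : ℂ :=
  cauchyTransform μ w + Complex.log (w - p.1) - Complex.log (w - p.1 - p.2 + 1)

/-- The asymptotic shape: `(χ, η) ∈ [a, b] × [0, 1]` with `b ≥ χ ≥ χ + η - 1 ≥ a`. -/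
def shape (a b : ℝ) : Set (ℝ × ℝ) :=
  {p | p ∈ Set.Icc a b ×ˢ Set.Icc (0 : ℝ) 1 ∧
    b ≥ p.1 ∧ p.1 ≥ p.1 + p.2 - 1 ∧ p.1 + p.2 - 1 ≥ a}

/-- The liquid region: the points of the shape for which `f'` has a non-real root. -/
def liquidRegion (μ : ProbabilityMeasure ℝ) (a b : ℝ) : Set (ℝ × ℝ) :=
  {p | p ∈ shape a b ∧ ∃ w : ℂ, w.im ≠ 0 ∧ fDeriv μ p w = 0}

/-- The common denominator `e^{C(w)} - e^{C(w̄)}`. -/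
def denom (μ : ProbabilityMeasure ℝ) (w : ℂ) : ℂ :=
  Complex.exp (cauchyTransform μ w) - Complex.exp (cauchyTransform μ (conj w))

/-- `χ_L(w) = w + (w - w̄)(e^{C(w̄)} - 1) / (e^{C(w)} - e^{C(w̄)})`. -/
def chiL (μ : ProbabilityMeasure ℝ) (w : ℂ) : ℂ :=
  w + (w - conj w) * (Complex.exp (cauchyTransform μ (conj w)) - 1) / denom μ w

/-- `η_L(w) = 1 + (w - w̄)(e^{C(w)} - 1)(e^{C(w̄)} - 1) / (e^{C(w)} - e^{C(w̄)})`. -/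
def etaL (μ : ProbabilityMeasure ℝ) (w : ℂ) : ℂ :=
  1 + (w - conj w) * (Complex.exp (cauchyTransform μ w) - 1) *
    (Complex.exp (cauchyTransform μ (conj w)) - 1) / denom μ w

end LiquidRegion

end

namespace LiquidRegion

/-! Distinct integers scaled by `1/n` cannot crowd, so `μ ≤ volume` and `μ` has a density `g` with
values in `[0, 1]`. Put `c = χ + η - 1` and `d = χ`. Then `f'(w) = ∫ s(x) / (w - x) dx` with `s = g
- 1_[c,d]`, which is nonpositive on `[c, d]` and nonnegative off it. Hence `s(x)(x - c)(x - d) ≥ 0`,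
and `s` is not a.e. zero because `b - a > 1`.

This sign pattern drives everything. By partial fractions, two roots `w ≠ v` in the upper half-plane
would give `∫ s (x - c)(x - d) / (|w - x|² |v - x|²) = 0`, contradicting positivity (`root_unique`);
the confluent case shows that roots are simple (`root_simple`). Lower-degree kernels show that a
root forces `η ≥ 0` and `a ≤ c`, `d ≤ b`, so the constraints of the shape are automatic.

Exponentiating, `f'(w) = 0` becomes `e^C (w - χ) = w - χ - η + 1`. Since `-π < Im C < 0` in the
upper half-plane, no branch ambiguity arises, and the equation forces `η < 1` (`exp_mul_eq_iff`).
Together with its conjugate it is a nonsingular linear system for real `(χ, η)`, solved by `chiL`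
and `etaL`. So each `w` determines exactly one point `Φ w`, and `Φ` is continuous. It is injective
by uniqueness of roots and open by simplicity and the implicit function theorem. Thus `Φ` is an open
embedding with range the liquid region. -/

/-! ### Domination by Lebesgue measure and the bounded density -/

theorem card_filter_div_mem_Ioo_le {n : ℕ} (hn : 0 < n) {x : Fin n → ℤ} (hx : Function.Injective x)
    {c d : ℝ} (hcd : c ≤ d) [DecidablePred fun i => (x i : ℝ) / n ∈ Set.Ioo c d] :
    ((Finset.univ.filter fun i => (x i : ℝ) / n ∈ Set.Ioo c d).card : ℝ) ≤ n * (d - c) + 1 := by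
  have hn' : (0 : ℝ) < n := by exact_mod_cast hn
  have h1 : (Finset.univ.filter fun i => (x i : ℝ) / n ∈ Set.Ioo c d).card ≤
      (Finset.Ioo ⌊n * c⌋ ⌈n * d⌉).card := by
    refine Finset.card_le_card_of_injOn x ?_ hx.injOn
    intro i hi
    simp only [Set.mem_Ioo, Finset.coe_filter, Finset.mem_univ, true_and, Set.mem_ofPred_eq,
      lt_div_iff₀ hn', div_lt_iff₀ hn'] at hi
    simp only [Finset.coe_Ioo, Set.mem_Ioo]
    exact ⟨Int.floor_lt.2 (by linarith), Int.lt_ceil.2 (by linarith)⟩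
  rw [Int.card_Ioo] at h1
  have h2 : ((⌈n * d⌉ - ⌊n * c⌋ - 1).toNat : ℝ) ≤ n * (d - c) + 1 := by
    have h3 : (((⌈n * d⌉ - ⌊n * c⌋ - 1).toNat : ℤ) : ℝ) ≤ n * (d - c) + 1 := by
      rw [Int.toNat_eq_max]
      push_cast
      refine max_le ?_ ?_
      · linarith [Int.ceil_lt_add_one (n * d), Int.lt_floor_add_one (n * c)]
      · nlinarith
    exact_mod_cast h3
  exact le_trans (by exact_mod_cast h1) h2

theorem empiricalMeasure_apply (n : ℕ) (x : Fin n → ℤ) {s : Set ℝ} (hs : MeasurableSet s)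
    [DecidablePred fun i => (x i : ℝ) / n ∈ s] :
    (empiricalMeasure n x : Measure ℝ) s =
      ENNReal.ofReal ((n : ℝ)⁻¹ *
        (Finset.univ.filter fun i => (x i : ℝ) / n ∈ s).card) := by
  classical
  have h1 : (empiricalMeasure n x : Measure ℝ) =
      ((n : ℝ≥0)⁻¹) • ∑ i, Measure.dirac ((x i : ℝ) / (n : ℝ)) := by
    rw [empiricalMeasure, FiniteMeasure.toMeasure_smul, FiniteMeasure.toMeasure_sum]
    rfl
  rw [h1, Measure.smul_apply, Measure.finsetSum_apply]
  simp only [Measure.dirac_apply' _ hs, Set.indicator_apply, Pi.one_apply, Finset.sum_boole]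
  rw [ENNReal.ofReal_mul (by positivity), ENNReal.ofReal_natCast, ENNReal.smul_def, smul_eq_mul]
  congr 1
  rw [← ENNReal.ofReal_coe_nnreal]
  simp

theorem empiricalMeasure_univ {n : ℕ} (hn : 0 < n) (x : Fin n → ℤ) :
    (empiricalMeasure n x : Measure ℝ) Set.univ = 1 := by
  have hn' : (n : ℝ) ≠ 0 := by exact_mod_cast hn.ne'
  rw [empiricalMeasure_apply n x MeasurableSet.univ]
  simp [hn']

variable {μ : ProbabilityMeasure ℝ} {a b : ℝ} {x : (n : ℕ) → Fin n → ℤ}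

/-- Portmanteau for open sets: the empirical measures give `Ioo c d` mass at most `(d - c) + 1/n`.
-/
theorem Admissible.measure_Ioo_le (h : Admissible μ a b x) {c d : ℝ} (hcd : c ≤ d) :
    (μ : Measure ℝ) (Set.Ioo c d) ≤ ENNReal.ofReal (d - c) := by
  -- The index is shifted because the empirical measure for `n = 0` is zero, not a probability
  -- measure.
  let P : ℕ → ProbabilityMeasure ℝ := fun n =>
    ⟨(empiricalMeasure (n + 1) (x (n + 1)) : Measure ℝ), ⟨empiricalMeasure_univ n.succ_pos _⟩⟩
  have hP : Tendsto P atTop (𝓝 μ) := by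
    rw [ProbabilityMeasure.tendsto_nhds_iff_toFiniteMeasure_tendsto_nhds]
    exact h.weak_limit.comp (tendsto_add_atTop_nat 1)
  refine (ProbabilityMeasure.le_liminf_measure_open_of_tendsto hP isOpen_Ioo).trans ?_
  have hb : ∀ n : ℕ, (P n : Measure ℝ) (Set.Ioo c d) ≤
      ENNReal.ofReal ((d - c) + 1 / ((n : ℝ) + 1)) := by
    intro n
    have e : (P n : Measure ℝ) (Set.Ioo c d) = _ :=
      empiricalMeasure_apply (n + 1) (x (n + 1)) measurableSet_Ioo
    rw [e]
    refine ENNReal.ofReal_le_ofReal ?_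
    have hn : (0 : ℝ) < ((n + 1 : ℕ) : ℝ) := by positivity
    refine (mul_le_mul_of_nonneg_left (card_filter_div_mem_Ioo_le (Nat.add_one_pos n)
      (h.strictAnti (n + 1)).injective hcd) (inv_nonneg.2 hn.le)).trans (le_of_eq ?_)
    push_cast at hn ⊢
    field_simp
  have ht : Tendsto (fun n : ℕ => ENNReal.ofReal ((d - c) + 1 / ((n : ℝ) + 1))) atTop
      (𝓝 (ENNReal.ofReal (d - c))) := by
    have := (tendsto_one_div_add_atTop_nhds_zero_nat (𝕜 := ℝ)).const_add (d - c)
    rw [add_zero] at this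
    exact ENNReal.tendsto_ofReal this
  rw [← ht.liminf_eq]
  exact liminf_le_liminf (Eventually.of_forall hb)

/-- The interval bound says that `t - F t`, with `F` the distribution function, is nondecreasing. It
is therefore a Stieltjes function, and its measure is the complement of `μ` in `volume`. -/
theorem Admissible.le_volume (h : Admissible μ a b x) : (μ : Measure ℝ) ≤ volume := by
  have key : ∀ c d : ℝ, c ≤ d → (μ : Measure ℝ) (Set.Ioc c d) ≤ ENNReal.ofReal (d - c) := by
    intro c d hcd
    have ht : Tendsto (fun n : ℕ => ENNReal.ofReal ((d - c) + 1 / ((n : ℝ) + 1))) atTop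
        (𝓝 (ENNReal.ofReal (d - c))) := by
      have := (tendsto_one_div_add_atTop_nhds_zero_nat (𝕜 := ℝ)).const_add (d - c)
      rw [add_zero] at this
      exact ENNReal.tendsto_ofReal this
    refine ge_of_tendsto' ht fun n => ?_
    have hn : (0 : ℝ) < 1 / ((n : ℝ) + 1) := by positivity
    refine (measure_mono (Set.Ioc_subset_Ioo_right (lt_add_of_pos_right d hn))).trans ?_
    refine (h.measure_Ioo_le (by linarith)).trans (le_of_eq ?_)
    congr 1
    ring
  let F := ProbabilityTheory.cdf (μ : Measure ℝ)
  have hF : ∀ c d, c ≤ d → F d - F c ≤ d - c := by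
    intro c d hcd
    have h1 := key c d hcd
    rw [← ProbabilityTheory.measure_cdf (μ : Measure ℝ), StieltjesFunction.measure_Ioc,
      ENNReal.ofReal_le_ofReal_iff (by linarith)] at h1
    exact h1
  let G : StieltjesFunction ℝ :=
    { toFun := fun t => t - F t
      mono' := fun c d hcd => by have := hF c d hcd; dsimp only; linarith
      right_continuous' := fun t => continuousWithinAt_id.sub (F.right_continuous t) }
  have hsum : F + G = StieltjesFunction.id := by
    ext t
    simp [G]
  have hv : (volume : Measure ℝ) = (μ : Measure ℝ) + G.measure := by
    rw [Real.volume_eq_stieltjes_id, ← hsum, StieltjesFunction.measure_add,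
      ProbabilityTheory.measure_cdf]
  rw [hv]
  exact Measure.le_add_right le_rfl

/-- `g` is a Lebesgue density of `μ` with values in `[0, 1]`, vanishing off `[a, b]`. -/
structure BoundedDensity (μ : ProbabilityMeasure ℝ) (a b : ℝ) (g : ℝ → ℝ) : Prop where
  measurable : Measurable g
  nonneg : ∀ x, 0 ≤ g x
  le_one : ∀ x, g x ≤ 1
  eq_zero : ∀ x, x ∉ Set.Icc a b → g x = 0
  withDensity : (μ : Measure ℝ) = volume.withDensity fun x => ENNReal.ofReal (g x)

theorem exists_boundedDensity {μ : ProbabilityMeasure ℝ} {a b : ℝ}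
    (hs : (μ : Measure ℝ).support ⊆ Set.Icc a b) (hle : (μ : Measure ℝ) ≤ volume) :
    ∃ g, BoundedDensity μ a b g := by
  have hac : (μ : Measure ℝ) ≪ volume := Measure.absolutelyContinuous_of_le hle
  let r := (μ : Measure ℝ).rnDeriv volume
  have hr : Measurable r := Measure.measurable_rnDeriv _ _
  have hr1 : ∀ᵐ x, r x ≤ 1 := Measure.rnDeriv_le_one_of_le hle
  have hmem : ∀ᵐ x ∂(μ : Measure ℝ), x ∈ Set.Icc a b :=
    mem_of_superset Measure.support_mem_ae hs
  have hres : (μ : Measure ℝ).restrict (Set.Icc a b) = μ := Measure.restrict_eq_self_of_ae_mem hmem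
  -- Truncation and the indicator alter the Radon-Nikodym derivative only on a null set, but make
  -- the bounds hold everywhere.
  refine ⟨(Set.Icc a b).indicator fun x => min 1 (r x).toReal, ?_, ?_, ?_, ?_, ?_⟩
  · exact (measurable_const.min hr.ennreal_toReal).indicator measurableSet_Icc
  · exact fun x => Set.indicator_nonneg (fun x _ => le_min zero_le_one ENNReal.toReal_nonneg) x
  · exact fun x => Set.indicator_le' (fun x _ => min_le_left _ _) (fun _ _ => zero_le_one) x
  · exact fun x hx => Set.indicator_of_notMem hx _
  · have h1 : (μ : Measure ℝ) = volume.withDensity ((Set.Icc a b).indicator r) := by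
      rw [withDensity_indicator measurableSet_Icc, ← restrict_withDensity measurableSet_Icc,
        Measure.withDensity_rnDeriv_eq _ _ hac, hres]
    conv_lhs => rw [h1]
    refine withDensity_congr_ae ?_
    filter_upwards [hr1] with x hx
    by_cases hxm : x ∈ Set.Icc a b
    · simp only [Set.indicator_of_mem hxm]
      have h2 : (r x).toReal ≤ 1 := by
        simpa using ENNReal.toReal_mono ENNReal.one_ne_top hx
      rw [min_eq_right h2, ENNReal.ofReal_toReal (ne_top_of_le_ne_top ENNReal.one_ne_top hx)]
    · simp [Set.indicator_of_notMem hxm]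

/-! ### Integrals against the signed density -/

theorem integrable_ofReal_mul {g : ℝ → ℝ} {A B : ℝ} (hg : Measurable g) (h1 : ∀ x, |g x| ≤ 1)
    (h0 : ∀ x, x ∉ Set.Icc A B → g x = 0) {K : ℝ → ℂ} (hK : Continuous K) :
    Integrable fun x => (g x : ℂ) * K x := by
  have h2 : IntegrableOn (fun x => (g x : ℂ) * K x) (Set.Icc A B) := by
    refine Integrable.bdd_mul (c := 1) (hK.integrableOn_Icc) ?_ ?_
    · exact (Complex.measurable_ofReal.comp hg).aestronglyMeasurable
    · exact Eventually.of_forall fun x => by simpa using h1 x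
  exact h2.integrable_of_forall_notMem_eq_zero fun x hx => by simp [h0 x hx]

/-- The density of the signed measure `μ - Leb|[c, d]`. -/
noncomputable def signedDensity (g : ℝ → ℝ) (c d : ℝ) (x : ℝ) : ℝ := g x - (Set.Icc c d).indicator 1 x

section
variable {μ : ProbabilityMeasure ℝ} {a b : ℝ} {g : ℝ → ℝ} (hg : BoundedDensity μ a b g)
include hg

theorem BoundedDensity.integrable {K : ℝ → ℂ} (hK : Continuous K) :
    Integrable fun x => (g x : ℂ) * K x :=
  integrable_ofReal_mul hg.measurable
    (fun x => abs_le.2 ⟨by linarith [hg.nonneg x], hg.le_one x⟩) hg.eq_zero hK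

theorem BoundedDensity.integrable_signed (c d : ℝ) {K : ℝ → ℂ} (hK : Continuous K) :
    Integrable fun x => (signedDensity g c d x : ℂ) * K x := by
  have h1 : Integrable fun x => (((Set.Icc c d).indicator 1 x : ℝ) : ℂ) * K x := by
    refine integrable_ofReal_mul (A := c) (B := d) (measurable_one.indicator measurableSet_Icc)
      (fun x => ?_) (fun x hx => Set.indicator_of_notMem hx _) hK
    by_cases hx : x ∈ Set.Icc c d <;> simp [hx]
  refine ((hg.integrable hK).sub h1).congr (Eventually.of_forall fun x => ?_)
  simp only [signedDensity, Pi.sub_apply]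
  push_cast
  ring

theorem BoundedDensity.integrable_signed_real (c d : ℝ) {K : ℝ → ℝ} (hK : Continuous K) :
    Integrable fun x => signedDensity g c d x * K x := by
  refine (hg.integrable_signed c d (Complex.continuous_ofReal.comp hK)).re.congr
    (Eventually.of_forall fun x => ?_)
  simp

theorem BoundedDensity.integral_eq (K : ℝ → ℂ) :
    ∫ x, K x ∂(μ : Measure ℝ) = ∫ x, (g x : ℂ) * K x := by
  rw [hg.withDensity, integral_withDensity_eq_integral_toReal_smul
    hg.measurable.ennreal_ofReal (Eventually.of_forall fun x => ENNReal.ofReal_lt_top)]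
  refine integral_congr_ae (Eventually.of_forall fun x => ?_)
  simp only [ENNReal.toReal_ofReal (hg.nonneg x)]
  exact Complex.real_smul

theorem BoundedDensity.integral_signed {c d : ℝ} (hcd : c ≤ d) {K : ℝ → ℂ} (hK : Continuous K) :
    ∫ x, (signedDensity g c d x : ℂ) * K x = ∫ x, K x ∂(μ : Measure ℝ) - ∫ x in c..d, K x := by
  have h1 : ∀ x, (((Set.Icc c d).indicator 1 x : ℝ) : ℂ) * K x = (Set.Icc c d).indicator K x := by
    intro x
    by_cases hx : x ∈ Set.Icc c d <;> simp [hx]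
  have h2 : Integrable ((Set.Icc c d).indicator K) :=
    (integrable_indicator_iff measurableSet_Icc).2 hK.integrableOn_Icc
  rw [hg.integral_eq, intervalIntegral.integral_of_le hcd, ← integral_Icc_eq_integral_Ioc,
    ← integral_indicator measurableSet_Icc, ← integral_sub (hg.integrable hK) h2]
  refine integral_congr_ae (Eventually.of_forall fun x => ?_)
  simp only [signedDensity, ← h1]
  push_cast
  ring

/-- Otherwise `μ` would be Lebesgue measure on an interval of length one, which cannot contain both
`a` and `b`. -/
theorem BoundedDensity.signed_ne_zero (hab : 1 < b - a) (ha : a ∈ (μ : Measure ℝ).support)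
    (hb : b ∈ (μ : Measure ℝ).support) (c d : ℝ) :
    ¬ ∀ᵐ x, signedDensity g c d x = 0 := by
  intro h0
  have h1 : (μ : Measure ℝ) = volume.restrict (Set.Icc c d) := by
    rw [hg.withDensity, ← withDensity_indicator_one measurableSet_Icc]
    refine withDensity_congr_ae ?_
    filter_upwards [h0] with x hx
    rw [sub_eq_zero.1 hx]
    by_cases hx : x ∈ Set.Icc c d <;> simp [hx]
  have h2 : (μ : Measure ℝ).support ⊆ Set.Icc c d := by
    refine Measure.support_subset_of_isClosed isClosed_Icc ?_
    rw [h1]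
    exact ae_restrict_mem measurableSet_Icc
  have h3 : (μ : Measure ℝ) Set.univ = 1 := measure_univ
  rw [h1, Measure.restrict_apply_univ, Real.volume_Icc] at h3
  have h4 : d - c = 1 := by simpa using h3
  have h5 := h2 ha
  have h6 := h2 hb
  linarith [h5.1, h6.2]

theorem BoundedDensity.integral_signed_pos (hab : 1 < b - a) (ha : a ∈ (μ : Measure ℝ).support)
    (hb : b ∈ (μ : Measure ℝ).support) (c d : ℝ) {K : ℝ → ℝ} (hK : Continuous K)
    (h0 : ∀ x, 0 ≤ signedDensity g c d x * K x) (hne : ∀ x, K x = 0 → x = c ∨ x = d) :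
    0 < ∫ x, signedDensity g c d x * K x := by
  refine lt_of_le_of_ne (integral_nonneg h0) fun he => ?_
  have h1 := (integral_eq_zero_iff_of_nonneg h0 (hg.integrable_signed_real c d hK)).1 he.symm
  refine hg.signed_ne_zero hab ha hb c d ?_
  have h2 : ∀ᵐ x : ℝ, x ∉ ({c, d} : Set ℝ) := (Set.toFinite _).countable.ae_notMem volume
  filter_upwards [h1, h2] with x hx hx2
  rcases mul_eq_zero.1 hx with h | h
  · exact h
  · exact absurd (hne x h) hx2

theorem BoundedDensity.signed_nonneg_of_notMem {c d x : ℝ} (hx : x ∉ Set.Icc c d) :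
    0 ≤ signedDensity g c d x := by
  simp [signedDensity, hx, hg.nonneg x]

theorem BoundedDensity.signed_nonpos_of_mem {c d x : ℝ} (hx : x ∈ Set.Icc c d) :
    signedDensity g c d x ≤ 0 := by
  simp [signedDensity, hx, hg.le_one x]

end

/-! ### Cauchy kernels, partial fractions and conjugation -/

theorem continuous_one_div_sub {w : ℂ} (hw : w.im ≠ 0) :
    Continuous fun x : ℝ => 1 / (w - (x : ℂ)) := by
  refine continuous_const.div (by fun_prop) fun x h => hw ?_
  have := congrArg Complex.im h
  simpa using this

theorem sub_ofReal_ne_zero {w : ℂ} (hw : w.im ≠ 0) (x : ℝ) : w - (x : ℂ) ≠ 0 := fun h => hw <| by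
  simpa using congrArg Complex.im h

theorem integral_one_div_sub {w : ℂ} (hw : w.im ≠ 0) (c d : ℝ) :
    ∫ x in c..d, 1 / (w - (x : ℂ)) = Complex.log (w - c) - Complex.log (w - d) := by
  have hd : ∀ x ∈ Set.uIcc c d, HasDerivAt (fun x : ℝ => -Complex.log (w - (x : ℂ)))
      (1 / (w - (x : ℂ))) x := by
    intro x _
    have h1 : HasDerivAt (fun x : ℝ => w - (x : ℂ)) (-1) x := by
      simpa using (Complex.ofRealCLM.hasDerivAt (x := x)).const_sub w
    have h2 : w - (x : ℂ) ∈ Complex.slitPlane := by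
      rw [Complex.mem_slitPlane_iff]
      right
      simpa using hw
    simpa only [neg_div, neg_neg] using (h1.clog_real h2).fun_neg
  rw [intervalIntegral.integral_eq_sub_of_hasDerivAt hd
    ((continuous_one_div_sub hw).intervalIntegrable _ _)]
  ring

/-- With `v = conj w` the denominator is `|w - x|²`, so vanishing Cauchy integrals yield integrals
of real kernels. -/
theorem quadratic_div_mul_eq {w v c d x : ℂ} (hwv : w - v ≠ 0) (hw : w - x ≠ 0) (hv : v - x ≠ 0) :
    (x - c) * (x - d) / ((w - x) * (v - x)) =
      1 - (w - c) * (w - d) / (w - v) * (1 / (w - x))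
        + (v - c) * (v - d) / (w - v) * (1 / (v - x)) := by
  field_simp
  ring

theorem affine_div_mul_eq {w v c x : ℂ} (hwv : w - v ≠ 0) (hw : w - x ≠ 0) (hv : v - x ≠ 0) :
    (x - c) / ((w - x) * (v - x)) =
      (v - c) / (w - v) * (1 / (v - x)) - (w - c) / (w - v) * (1 / (w - x)) := by
  field_simp
  ring

theorem exists_quadratic_div_sq_mul_sq_eq {w v : ℂ} (hwv : w - v ≠ 0) (c d : ℂ) :
    ∃ α β γ δ : ℂ, ∀ x, w - x ≠ 0 → v - x ≠ 0 →
      (x - c) * (x - d) / ((w - x) ^ 2 * (v - x) ^ 2) =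
        α * (1 / (w - x)) + β * (1 / (w - x) ^ 2) + γ * (1 / (v - x)) + δ * (1 / (v - x) ^ 2) := by
  refine ⟨2 * ((w - c) * (w - d)) / (w - v) ^ 3 - (w - c + (w - d)) / (w - v) ^ 2,
    (w - c) * (w - d) / (w - v) ^ 2,
    -(2 * ((v - c) * (v - d))) / (w - v) ^ 3 - (v - c + (v - d)) / (w - v) ^ 2,
    (v - c) * (v - d) / (w - v) ^ 2, fun x hw hv => ?_⟩
  field_simp
  ring

theorem exists_quadratic_div_prod_four_eq {z₁ z₂ z₃ z₄ : ℂ} (h₁₂ : z₁ - z₂ ≠ 0) (h₁₃ : z₁ - z₃ ≠ 0)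
    (h₁₄ : z₁ - z₄ ≠ 0) (h₂₃ : z₂ - z₃ ≠ 0) (h₂₄ : z₂ - z₄ ≠ 0) (h₃₄ : z₃ - z₄ ≠ 0) (c d : ℂ) :
    ∃ α β γ δ : ℂ, ∀ x, z₁ - x ≠ 0 → z₂ - x ≠ 0 → z₃ - x ≠ 0 → z₄ - x ≠ 0 →
      (x - c) * (x - d) / ((z₁ - x) * (z₂ - x) * ((z₃ - x) * (z₄ - x))) =
        α * (1 / (z₁ - x)) + β * (1 / (z₂ - x)) + γ * (1 / (z₃ - x)) + δ * (1 / (z₄ - x)) := by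
  refine ⟨-((z₁ - c) * (z₁ - d) / ((z₁ - z₂) * (z₁ - z₃) * (z₁ - z₄))),
    (z₂ - c) * (z₂ - d) / ((z₁ - z₂) * (z₂ - z₃) * (z₂ - z₄)),
    -((z₃ - c) * (z₃ - d) / ((z₁ - z₃) * (z₂ - z₃) * (z₃ - z₄))),
    (z₄ - c) * (z₄ - d) / ((z₁ - z₄) * (z₂ - z₄) * (z₃ - z₄)), fun x h₁ h₂ h₃ h₄ => ?_⟩
  field_simp
  ring

theorem integral_mul_combination_eq_zero {s K k₁ k₂ k₃ k₄ : ℝ → ℂ} {α β γ δ : ℂ}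
    (hK : ∀ x, K x = α * k₁ x + β * k₂ x + γ * k₃ x + δ * k₄ x)
    (i₁ : Integrable fun x => s x * k₁ x) (i₂ : Integrable fun x => s x * k₂ x)
    (i₃ : Integrable fun x => s x * k₃ x) (i₄ : Integrable fun x => s x * k₄ x)
    (h₁ : ∫ x, s x * k₁ x = 0) (h₂ : ∫ x, s x * k₂ x = 0)
    (h₃ : ∫ x, s x * k₃ x = 0) (h₄ : ∫ x, s x * k₄ x = 0) : ∫ x, s x * K x = 0 := by
  have e : (fun x => s x * K x) = fun x =>
      (α * (s x * k₁ x) + β * (s x * k₂ x)) + (γ * (s x * k₃ x) + δ * (s x * k₄ x)) := by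
    ext x
    rw [hK]
    ring
  rw [e, integral_add (by exact (i₁.const_mul α).add (i₂.const_mul β))
    (by exact (i₃.const_mul γ).add (i₄.const_mul δ)),
    integral_add (i₁.const_mul α) (i₂.const_mul β), integral_add (i₃.const_mul γ) (i₄.const_mul δ)]
  simp only [integral_const_mul, h₁, h₂, h₃, h₄, mul_zero, add_zero]

theorem ofReal_normSq_sub (w : ℂ) (x : ℝ) :
    (Complex.normSq (w - x) : ℂ) = (w - x) * (conj w - x) := by
  rw [← Complex.mul_conj, map_sub, Complex.conj_ofReal]

theorem sub_conj_ne_zero {w : ℂ} (hw : w.im ≠ 0) : w - conj w ≠ 0 := fun h => hw <| by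
  have := congrArg Complex.im h
  simp only [Complex.sub_im, Complex.conj_im, Complex.zero_im] at this
  linarith

theorem normSq_sub_pos {w : ℂ} (hw : w.im ≠ 0) (x : ℝ) : 0 < Complex.normSq (w - x) :=
  Complex.normSq_pos.2 (sub_ofReal_ne_zero hw x)

theorem continuous_normSq_sub (w : ℂ) : Continuous fun x : ℝ => Complex.normSq (w - x) :=
  Complex.continuous_normSq.comp (by fun_prop)

theorem integral_ofReal_mul_conj (s : ℝ → ℝ) (K : ℝ → ℂ) :
    ∫ x, (s x : ℂ) * conj (K x) = conj (∫ x, (s x : ℂ) * K x) := by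
  rw [← integral_conj]
  simp

theorem integral_ofReal_mul_one_div_conj (s : ℝ → ℝ) (w : ℂ) :
    ∫ x : ℝ, (s x : ℂ) * (1 / (conj w - x)) = conj (∫ x : ℝ, (s x : ℂ) * (1 / (w - x))) := by
  rw [← integral_ofReal_mul_conj]
  simp

theorem integral_ofReal_mul_one_div_sq_conj (s : ℝ → ℝ) (w : ℂ) :
    ∫ x : ℝ, (s x : ℂ) * (1 / (conj w - x) ^ 2) =
      conj (∫ x : ℝ, (s x : ℂ) * (1 / (w - x) ^ 2)) := by
  rw [← integral_ofReal_mul_conj]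
  simp

theorem continuous_one_div_sub_sq {w : ℂ} (hw : w.im ≠ 0) :
    Continuous fun x : ℝ => 1 / (w - (x : ℂ)) ^ 2 := by
  simpa [one_div, inv_pow] using (continuous_one_div_sub hw).fun_pow 2

/-! ### Consequences of a root: location, uniqueness, simplicity -/

section
variable {μ : ProbabilityMeasure ℝ} {a b : ℝ} {g : ℝ → ℝ} (hg : BoundedDensity μ a b g)
include hg

theorem BoundedDensity.integral_affine_eq_zero {c d : ℝ} {w : ℂ} (hw : w.im ≠ 0)
    (h : ∫ x : ℝ, (signedDensity g c d x : ℂ) * (1 / (w - x)) = 0) (e : ℝ) :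
    ∫ x, signedDensity g c d x * ((x - e) / Complex.normSq (w - x)) = 0 := by
  have hw' : (conj w).im ≠ 0 := by simpa using hw
  have h' : ∫ x : ℝ, (signedDensity g c d x : ℂ) * (1 / (conj w - x)) = 0 := by
    rw [integral_ofReal_mul_one_div_conj, h, map_zero]
  apply Complex.ofReal_injective
  rw [← integral_complex_ofReal]
  have key : ∀ x : ℝ, ((signedDensity g c d x * ((x - e) / Complex.normSq (w - x)) : ℝ) : ℂ) =
      (conj w - e) / (w - conj w) * (signedDensity g c d x * (1 / (conj w - x)))
      - (w - e) / (w - conj w) * (signedDensity g c d x * (1 / (w - x))) := by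
    intro x
    push_cast
    rw [ofReal_normSq_sub, affine_div_mul_eq (sub_conj_ne_zero hw) (sub_ofReal_ne_zero hw x)
      (sub_ofReal_ne_zero hw' x)]
    ring
  simp_rw [key]
  rw [integral_sub ((hg.integrable_signed c d (continuous_one_div_sub hw')).const_mul _)
    ((hg.integrable_signed c d (continuous_one_div_sub hw)).const_mul _),
    integral_const_mul, integral_const_mul, h, h']
  simp

/-- In the partial fractions only the constant term survives, contributing the total mass of the
signed density. -/
theorem BoundedDensity.integral_quadratic_eq {c d : ℝ} {w : ℂ} (hw : w.im ≠ 0)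
    (h : ∫ x : ℝ, (signedDensity g c d x : ℂ) * (1 / (w - x)) = 0) (hcd : c ≤ d) :
    ∫ x, signedDensity g c d x * ((x - c) * (x - d) / Complex.normSq (w - x)) = 1 - (d - c) := by
  have hw' : (conj w).im ≠ 0 := by simpa using hw
  have h' : ∫ x : ℝ, (signedDensity g c d x : ℂ) * (1 / (conj w - x)) = 0 := by
    rw [integral_ofReal_mul_one_div_conj, h, map_zero]
  have h1 : ∫ x : ℝ, (signedDensity g c d x : ℂ) * 1 = 1 - (d - c) := by
    rw [hg.integral_signed hcd continuous_const]
    simp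
  apply Complex.ofReal_injective
  rw [← integral_complex_ofReal]
  have key : ∀ x : ℝ,
      ((signedDensity g c d x * ((x - c) * (x - d) / Complex.normSq (w - x)) : ℝ) : ℂ) =
      signedDensity g c d x * 1
      - (w - c) * (w - d) / (w - conj w) * (signedDensity g c d x * (1 / (w - x)))
      + (conj w - c) * (conj w - d) / (w - conj w)
        * (signedDensity g c d x * (1 / (conj w - x))) := by
    intro x
    push_cast
    rw [ofReal_normSq_sub, quadratic_div_mul_eq (sub_conj_ne_zero hw) (sub_ofReal_ne_zero hw x)
      (sub_ofReal_ne_zero hw' x)]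
    ring
  simp_rw [key]
  have i1 := (hg.integrable_signed c d (continuous_one_div_sub hw)).const_mul
    ((w - c) * (w - d) / (w - conj w))
  have i2 := (hg.integrable_signed c d (continuous_one_div_sub hw')).const_mul
    ((conj w - c) * (conj w - d) / (w - conj w))
  have i0 := hg.integrable_signed c d (K := fun _ => 1) continuous_const
  rw [integral_add (by exact i0.sub i1) i2, integral_sub i0 i1, integral_const_mul, integral_const_mul,
    h, h', h1]
  simp

theorem BoundedDensity.integral_four_eq_zero {c d : ℝ} {w v : ℂ} (hw : w.im ≠ 0) (hv : v.im ≠ 0)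
    (hwv : w ≠ v) (hwv' : w ≠ conj v)
    (h : ∫ x : ℝ, (signedDensity g c d x : ℂ) * (1 / (w - x)) = 0)
    (hh : ∫ x : ℝ, (signedDensity g c d x : ℂ) * (1 / (v - x)) = 0) :
    ∫ x, signedDensity g c d x *
      ((x - c) * (x - d) / (Complex.normSq (w - x) * Complex.normSq (v - x))) = 0 := by
  have hw' : (conj w).im ≠ 0 := by simpa using hw
  have hv' : (conj v).im ≠ 0 := by simpa using hv
  have h' : ∫ x : ℝ, (signedDensity g c d x : ℂ) * (1 / (conj w - x)) = 0 := by
    rw [integral_ofReal_mul_one_div_conj, h, map_zero]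
  have hh' : ∫ x : ℝ, (signedDensity g c d x : ℂ) * (1 / (conj v - x)) = 0 := by
    rw [integral_ofReal_mul_one_div_conj, hh, map_zero]
  apply Complex.ofReal_injective
  rw [← integral_complex_ofReal]
  obtain ⟨α, β, γ, δ, key⟩ := exists_quadratic_div_prod_four_eq (sub_conj_ne_zero hw)
    (sub_ne_zero.2 hwv) (sub_ne_zero.2 hwv')
    (sub_ne_zero.2 fun e => hwv' (by rw [← e, Complex.conj_conj]))
    (sub_ne_zero.2 fun e => hwv ((starRingEnd ℂ).injective e)) (sub_conj_ne_zero hv) (c : ℂ) (d : ℂ)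
  simp only [Complex.ofReal_mul (signedDensity g c d _)]
  refine integral_mul_combination_eq_zero (α := α) (β := β) (γ := γ) (δ := δ) (fun x => ?_)
    (hg.integrable_signed c d (continuous_one_div_sub hw))
    (hg.integrable_signed c d (continuous_one_div_sub hw'))
    (hg.integrable_signed c d (continuous_one_div_sub hv))
    (hg.integrable_signed c d (continuous_one_div_sub hv')) h h' hh hh'
  push_cast
  rw [ofReal_normSq_sub, ofReal_normSq_sub]
  exact key x (sub_ofReal_ne_zero hw x) (sub_ofReal_ne_zero hw' x)
    (sub_ofReal_ne_zero hv x) (sub_ofReal_ne_zero hv' x)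

theorem BoundedDensity.integral_double_eq_zero {c d : ℝ} {w : ℂ} (hw : w.im ≠ 0)
    (h : ∫ x : ℝ, (signedDensity g c d x : ℂ) * (1 / (w - x)) = 0)
    (hh : ∫ x : ℝ, (signedDensity g c d x : ℂ) * (1 / (w - x) ^ 2) = 0) :
    ∫ x, signedDensity g c d x * ((x - c) * (x - d) / Complex.normSq (w - x) ^ 2) = 0 := by
  have hw' : (conj w).im ≠ 0 := by simpa using hw
  have h' : ∫ x : ℝ, (signedDensity g c d x : ℂ) * (1 / (conj w - x)) = 0 := by
    rw [integral_ofReal_mul_one_div_conj, h, map_zero]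
  have hh' : ∫ x : ℝ, (signedDensity g c d x : ℂ) * (1 / (conj w - x) ^ 2) = 0 := by
    rw [integral_ofReal_mul_one_div_sq_conj, hh, map_zero]
  apply Complex.ofReal_injective
  rw [← integral_complex_ofReal]
  obtain ⟨α, β, γ, δ, key⟩ :=
    exists_quadratic_div_sq_mul_sq_eq (sub_conj_ne_zero hw) (c : ℂ) (d : ℂ)
  simp only [Complex.ofReal_mul (signedDensity g c d _)]
  refine integral_mul_combination_eq_zero (α := α) (β := β) (γ := γ) (δ := δ) (fun x => ?_)
    (hg.integrable_signed c d (continuous_one_div_sub hw))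
    (hg.integrable_signed c d (continuous_one_div_sub_sq hw))
    (hg.integrable_signed c d (continuous_one_div_sub hw'))
    (hg.integrable_signed c d (continuous_one_div_sub_sq hw')) h hh h' hh'
  push_cast
  rw [ofReal_normSq_sub, mul_pow]
  exact key x (sub_ofReal_ne_zero hw x) (sub_ofReal_ne_zero hw' x)

theorem BoundedDensity.signed_mul_quadratic_nonneg {c d : ℝ} (hcd : c ≤ d) (x : ℝ) :
    0 ≤ signedDensity g c d x * ((x - c) * (x - d)) := by
  by_cases hx : x ∈ Set.Icc c d
  · exact mul_nonneg_of_nonpos_of_nonpos (hg.signed_nonpos_of_mem hx)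
      (mul_nonpos_of_nonneg_of_nonpos (sub_nonneg.2 hx.1) (sub_nonpos.2 hx.2))
  · refine mul_nonneg (hg.signed_nonneg_of_notMem hx) ?_
    rw [Set.mem_Icc, not_and_or, not_le, not_le] at hx
    rcases hx with hx | hx
    · exact mul_nonneg_of_nonpos_of_nonpos (by linarith) (by linarith)
    · exact mul_nonneg (by linarith) (by linarith)

variable (hab : 1 < b - a) (ha : a ∈ (μ : Measure ℝ).support) (hb : b ∈ (μ : Measure ℝ).support)
include hab ha hb

theorem BoundedDensity.integral_quadratic_div_pos {c d : ℝ} (hcd : c ≤ d) {k : ℝ → ℝ}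
    (hk : Continuous k) (hpos : ∀ x, 0 < k x) :
    0 < ∫ x, signedDensity g c d x * ((x - c) * (x - d) / k x) := by
  refine hg.integral_signed_pos hab ha hb c d ?_ (fun x => ?_) (fun x hx => ?_)
  · exact Continuous.div (by fun_prop) hk fun x => (hpos x).ne'
  · rw [← mul_div_assoc]
    exact div_nonneg (hg.signed_mul_quadratic_nonneg hcd x) (hpos x).le
  · rw [div_eq_zero_iff, or_iff_left (hpos x).ne', mul_eq_zero, sub_eq_zero, sub_eq_zero] at hx
    exact hx

theorem BoundedDensity.sub_le_one_of_root {c d : ℝ} (hcd : c ≤ d) {w : ℂ} (hw : w.im ≠ 0)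
    (h : ∫ x : ℝ, (signedDensity g c d x : ℂ) * (1 / (w - x)) = 0) : d - c ≤ 1 := by
  have h1 := hg.integral_quadratic_div_pos hab ha hb hcd (continuous_normSq_sub w)
    (normSq_sub_pos hw)
  rw [hg.integral_quadratic_eq hw h hcd] at h1
  linarith

/-- If `d > b`, the signed density vanishes to the right of `d`, so its only sign change is at `c`
and an affine factor already makes the integrand nonnegative. -/
theorem BoundedDensity.le_right_of_root {c d : ℝ} {w : ℂ} (hw : w.im ≠ 0)
    (h : ∫ x : ℝ, (signedDensity g c d x : ℂ) * (1 / (w - x)) = 0) : d ≤ b := by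
  by_contra! hlt
  have h1 : 0 < ∫ x, signedDensity g c d x * -((x - c) / Complex.normSq (w - x)) := by
    refine hg.integral_signed_pos hab ha hb c d ?_ (fun x => ?_) (fun x hx => ?_)
    · exact (Continuous.div (by fun_prop) (continuous_normSq_sub w)
        fun x => (normSq_sub_pos hw x).ne').neg
    · rw [← neg_div]
      have hn := normSq_sub_pos hw x
      by_cases hx : x ∈ Set.Icc c d
      · exact mul_nonneg_of_nonpos_of_nonpos (hg.signed_nonpos_of_mem hx)
          (div_nonpos_of_nonpos_of_nonneg (by linarith [hx.1]) hn.le)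
      · rcases lt_or_ge x c with hxc | hxc
        · exact mul_nonneg (hg.signed_nonneg_of_notMem hx) (div_nonneg (by linarith) hn.le)
        · have hxd : d < x := by
            by_contra! hh
            exact hx ⟨hxc, hh⟩
          have : signedDensity g c d x = 0 := by
            simp [signedDensity, hx, hg.eq_zero x fun hm => by linarith [hm.2]]
          rw [this, zero_mul]
    · rw [neg_eq_zero, div_eq_zero_iff, or_iff_left (normSq_sub_pos hw x).ne'] at hx
      exact Or.inl (by linarith)
  simp only [mul_neg, integral_neg, hg.integral_affine_eq_zero hw h, neg_zero, lt_self_iff_false]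
    at h1

theorem BoundedDensity.left_le_of_root {c d : ℝ} {w : ℂ} (hw : w.im ≠ 0)
    (h : ∫ x : ℝ, (signedDensity g c d x : ℂ) * (1 / (w - x)) = 0) : a ≤ c := by
  by_contra! hlt
  have h1 : 0 < ∫ x, signedDensity g c d x * ((x - d) / Complex.normSq (w - x)) := by
    refine hg.integral_signed_pos hab ha hb c d ?_ (fun x => ?_) (fun x hx => ?_)
    · exact (Continuous.div (by fun_prop) (continuous_normSq_sub w)
        fun x => (normSq_sub_pos hw x).ne')
    · have hn := normSq_sub_pos hw x
      by_cases hx : x ∈ Set.Icc c d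
      · exact mul_nonneg_of_nonpos_of_nonpos (hg.signed_nonpos_of_mem hx)
          (div_nonpos_of_nonpos_of_nonneg (by linarith [hx.2]) hn.le)
      · rcases lt_or_ge d x with hxd | hxd
        · exact mul_nonneg (hg.signed_nonneg_of_notMem hx) (div_nonneg (by linarith) hn.le)
        · have hxc : x < c := by
            by_contra! hh
            exact hx ⟨hh, hxd⟩
          have : signedDensity g c d x = 0 := by
            simp [signedDensity, hx, hg.eq_zero x fun hm => by linarith [hm.1]]
          rw [this, zero_mul]
    · rw [div_eq_zero_iff, or_iff_left (normSq_sub_pos hw x).ne'] at hx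
      exact Or.inr (by linarith)
  simp only [hg.integral_affine_eq_zero hw h, lt_self_iff_false] at h1

theorem BoundedDensity.root_unique {c d : ℝ} (hcd : c ≤ d) {w v : ℂ} (hw : 0 < w.im)
    (hv : 0 < v.im) (h : ∫ x : ℝ, (signedDensity g c d x : ℂ) * (1 / (w - x)) = 0)
    (hh : ∫ x : ℝ, (signedDensity g c d x : ℂ) * (1 / (v - x)) = 0) : w = v := by
  by_contra hne
  have hne' : w ≠ conj v := fun e => by
    have := congrArg Complex.im e
    rw [Complex.conj_im] at this
    linarith
  have h1 := hg.integral_quadratic_div_pos hab ha hb hcd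
    ((continuous_normSq_sub w).fun_mul (continuous_normSq_sub v))
    (fun x => mul_pos (normSq_sub_pos hw.ne' x) (normSq_sub_pos hv.ne' x))
  rw [hg.integral_four_eq_zero hw.ne' hv.ne' hne hne' h hh] at h1
  exact lt_irrefl _ h1

theorem BoundedDensity.root_simple {c d : ℝ} (hcd : c ≤ d) {w : ℂ} (hw : w.im ≠ 0)
    (h : ∫ x : ℝ, (signedDensity g c d x : ℂ) * (1 / (w - x)) = 0) :
    ∫ x : ℝ, (signedDensity g c d x : ℂ) * (1 / (w - x) ^ 2) ≠ 0 := by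
  intro hh
  have h1 := hg.integral_quadratic_div_pos hab ha hb hcd ((continuous_normSq_sub w).fun_pow 2)
    (fun x => pow_pos (normSq_sub_pos hw x) 2)
  rw [hg.integral_double_eq_zero hw h hh] at h1
  exact lt_irrefl _ h1

end

/-! ### Conjugation symmetry, arguments and differentiability of the Cauchy transform -/

theorem cauchyTransform_conj (μ : ProbabilityMeasure ℝ) (w : ℂ) :
    cauchyTransform μ (conj w) = conj (cauchyTransform μ w) := by
  rw [cauchyTransform, cauchyTransform, ← integral_conj]
  simp

theorem fDeriv_conj (μ : ProbabilityMeasure ℝ) (p : ℝ × ℝ) {w : ℂ} (hw : w.im ≠ 0) :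
    fDeriv μ p (conj w) = conj (fDeriv μ p w) := by
  have key : ∀ z : ℂ, z.im ≠ 0 → Complex.log (conj z) = conj (Complex.log z) := fun z hz =>
    Complex.log_conj z fun h => hz (Complex.arg_eq_pi_iff.1 h).2
  simp only [fDeriv, map_sub, map_add]
  rw [cauchyTransform_conj, ← key _ (by simpa using hw), ← key _ (by simpa using hw)]
  simp

theorem arg_pos_of_im_pos {z : ℂ} (hz : 0 < z.im) : 0 < z.arg := by
  refine lt_of_le_of_ne (Complex.arg_nonneg_iff.2 hz.le) fun h => ?_
  exact hz.ne' (Complex.arg_eq_zero_iff.1 h.symm).2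

theorem arg_lt_pi_of_im_pos {z : ℂ} (hz : 0 < z.im) : z.arg < Real.pi :=
  lt_of_le_of_ne (Complex.arg_le_pi z) fun h => hz.ne' (Complex.arg_eq_pi_iff.1 h).2

/-- Here `Im e^C < 0`; imaginary parts in `(e^C - 1)|w - d|² = (d - c)(conj w - d)` then fix the
sign of `d - c`. This is what makes `η < 1` automatic. -/
theorem lt_of_exp_mul_eq {C w : ℂ} (hC : C.im ∈ Set.Ioo (-Real.pi) 0) (hw : 0 < w.im) {c d : ℝ}
    (h : Complex.exp C * (w - d) = w - c) : c < d := by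
  have hE : (Complex.exp C).im < 0 := by
    rw [Complex.exp_im]
    exact mul_neg_of_pos_of_neg (Real.exp_pos _) (Real.sin_neg_of_neg_of_neg_pi_lt hC.2 hC.1)
  have h1 : (Complex.exp C - 1) * (w - d) = ((d - c : ℝ) : ℂ) := by
    rw [sub_mul, h]
    push_cast
    ring
  have h2 : (Complex.exp C - 1) * Complex.normSq (w - d) = ((d - c : ℝ) : ℂ) * (conj w - d) := by
    rw [ofReal_normSq_sub, ← h1]
    ring
  have h3 := congrArg Complex.im h2
  simp only [Complex.im_mul_ofReal, Complex.im_ofReal_mul, Complex.sub_im, Complex.one_im,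
    Complex.conj_im, Complex.ofReal_im, sub_zero] at h3
  have h4 := mul_neg_of_neg_of_pos hE (normSq_sub_pos hw.ne' d)
  rw [h3] at h4
  nlinarith

theorem arg_sub_ofReal_le {w : ℂ} (hw : 0 < w.im) {c d : ℝ} (hcd : c ≤ d) :
    (w - c).arg ≤ (w - d).arg := by
  have h1 := congrArg Complex.im (integral_one_div_sub hw.ne' c d)
  rw [Complex.sub_im, Complex.log_im, Complex.log_im, intervalIntegral.integral_of_le hcd] at h1
  have hi : IntegrableOn (fun x : ℝ => 1 / (w - (x : ℂ))) (Set.Ioc c d) :=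
    (continuous_one_div_sub hw.ne').integrableOn_Ioc
  have h2 := integral_im hi
  simp only [RCLike.im_to_complex] at h2
  have h3 : ∫ x in Set.Ioc c d, (1 / (w - (x : ℂ))).im ≤ 0 := by
    refine integral_nonpos fun x => ?_
    have := div_pos hw (normSq_sub_pos hw.ne' x)
    simp only [one_div, Complex.inv_im, Complex.sub_im, Complex.ofReal_im, sub_zero, neg_div,
      Pi.zero_apply]
    linarith
  linarith

theorem integral_one_div_sub_sq {w : ℂ} (hw : w.im ≠ 0) (c d : ℝ) :
    ∫ x in c..d, 1 / (w - (x : ℂ)) ^ 2 = 1 / (w - d) - 1 / (w - c) := by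
  have hd : ∀ x ∈ Set.uIcc c d, HasDerivAt (fun x : ℝ => 1 / (w - (x : ℂ)))
      (1 / (w - (x : ℂ)) ^ 2) x := by
    intro x _
    have h1 : HasDerivAt (fun x : ℝ => w - (x : ℂ)) (-1) x := by
      simpa using (Complex.ofRealCLM.hasDerivAt (x := x)).const_sub w
    simpa [one_div] using h1.fun_inv (sub_ofReal_ne_zero hw x)
  rw [intervalIntegral.integral_eq_sub_of_hasDerivAt hd
    ((continuous_one_div_sub_sq hw).intervalIntegrable _ _)]

theorem hasDerivAt_cauchyTransform (μ : ProbabilityMeasure ℝ) {w : ℂ} (hw : w.im ≠ 0) :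
    HasDerivAt (cauchyTransform μ) (-∫ x : ℝ, 1 / (w - x) ^ 2 ∂(μ : Measure ℝ)) w := by
  have hr : 0 < |w.im| / 2 := by positivity
  have him : ∀ z ∈ Metric.ball w (|w.im| / 2), |w.im| / 2 ≤ |z.im| := by
    intro z hz
    have h1 : |z.im - w.im| < |w.im| / 2 := by
      rw [← Complex.sub_im]
      exact (Complex.abs_im_le_norm _).trans_lt (mem_ball_iff_norm.1 hz)
    have h2 := abs_sub_abs_le_abs_sub w.im z.im
    rw [abs_sub_comm] at h2
    linarith
  have hne : ∀ z ∈ Metric.ball w (|w.im| / 2), z.im ≠ 0 := fun z hz h => by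
    have := him z hz
    rw [h, abs_zero] at this
    linarith
  have hlow : ∀ z ∈ Metric.ball w (|w.im| / 2), ∀ x : ℝ, |w.im| / 2 ≤ ‖z - x‖ := fun z hz x =>
    (him z hz).trans (by simpa using Complex.abs_im_le_norm (z - x))
  have hwm := Metric.mem_ball_self (x := w) hr
  have := (hasDerivAt_integral_of_dominated_loc_of_deriv_le (μ := (μ : Measure ℝ))
    (F := fun z (x : ℝ) => 1 / (z - (x : ℂ))) (F' := fun z (x : ℝ) => -(1 / (z - (x : ℂ)) ^ 2))
    (bound := fun _ => 1 / (|w.im| / 2) ^ 2) (x₀ := w) (Metric.ball_mem_nhds w hr) ?_ ?_ ?_ ?_ ?_ ?_).2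
  · rw [integral_neg] at this
    exact this
  · filter_upwards [Metric.ball_mem_nhds w hr] with z hz
    exact (continuous_one_div_sub (hne z hz)).aestronglyMeasurable
  · refine Integrable.of_bound (continuous_one_div_sub hw).aestronglyMeasurable (1 / (|w.im| / 2))
      (Eventually.of_forall fun x => ?_)
    rw [norm_div, norm_one]
    exact one_div_le_one_div_of_le hr (hlow w hwm x)
  · exact (continuous_one_div_sub_sq hw).neg.aestronglyMeasurable
  · refine Eventually.of_forall fun x z hz => ?_
    rw [norm_neg, norm_div, norm_one, norm_pow]
    exact one_div_le_one_div_of_le (by positivity) (pow_le_pow_left₀ hr.le (hlow z hz x) 2)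
  · exact integrable_const _
  · refine Eventually.of_forall fun x z hz => ?_
    have h1 : HasDerivAt (fun z : ℂ => z - (x : ℂ)) 1 z := (hasDerivAt_id z).sub_const _
    simpa [one_div, neg_div] using h1.fun_inv (sub_ofReal_ne_zero (hne z hz) x)

theorem contDiffAt_cauchyTransform (μ : ProbabilityMeasure ℝ) {w : ℂ} (hw : w.im ≠ 0) :
    ContDiffAt ℂ 1 (cauchyTransform μ) w := by
  have ho : IsOpen {z : ℂ | z.im ≠ 0} := isOpen_ne_fun Complex.continuous_im continuous_const
  have hd : DifferentiableOn ℂ (cauchyTransform μ) {z : ℂ | z.im ≠ 0} := fun z hz =>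
    (hasDerivAt_cauchyTransform μ hz).differentiableAt.differentiableWithinAt
  exact (hd.analyticAt (ho.mem_nhds hw)).contDiffAt

/-! ### The exponentiated root equation -/

section
variable {μ : ProbabilityMeasure ℝ} {a b : ℝ} {g : ℝ → ℝ} (hg : BoundedDensity μ a b g)
include hg

theorem BoundedDensity.integral_signed_one_div {c d : ℝ} (hcd : c ≤ d) {w : ℂ} (hw : w.im ≠ 0) :
    ∫ x : ℝ, (signedDensity g c d x : ℂ) * (1 / (w - x)) =
      cauchyTransform μ w + Complex.log (w - d) - Complex.log (w - c) := by
  rw [hg.integral_signed hcd (continuous_one_div_sub hw), integral_one_div_sub hw, cauchyTransform]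
  ring

theorem BoundedDensity.fDeriv_eq {p : ℝ × ℝ} (hp : p.2 ≤ 1) {w : ℂ} (hw : w.im ≠ 0) :
    fDeriv μ p w =
      ∫ x : ℝ, (signedDensity g (p.1 + p.2 - 1) p.1 x : ℂ) * (1 / (w - x)) := by
  rw [hg.integral_signed_one_div (by linarith) hw, fDeriv]
  congr 2
  push_cast
  ring

theorem BoundedDensity.im_integral_signed (c d : ℝ) {w : ℂ} (hw : w.im ≠ 0) :
    (∫ x : ℝ, (signedDensity g c d x : ℂ) * (1 / (w - x))).im =
      ∫ x, signedDensity g c d x * -(w.im / Complex.normSq (w - x)) := by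
  have h := integral_im (hg.integrable_signed c d (continuous_one_div_sub hw))
  simp only [RCLike.im_to_complex] at h
  rw [← h]
  refine integral_congr_ae (Eventually.of_forall fun x => ?_)
  simp [neg_div]

variable (hab : 1 < b - a) (ha : a ∈ (μ : Measure ℝ).support) (hb : b ∈ (μ : Measure ℝ).support)
include hab ha hb

/-- Comparing `μ` with Lebesgue measure on `[a, b]` gives `Im C > arg (w - a) - arg (w - b) > -π`;
negativity is that of the kernel `Im (1 / (w - x))`. -/
theorem BoundedDensity.cauchyTransform_im_mem {w : ℂ} (hw : 0 < w.im) :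
    (cauchyTransform μ w).im ∈ Set.Ioo (-Real.pi) 0 := by
  have hk : Continuous fun x : ℝ => w.im / Complex.normSq (w - x) :=
    continuous_const.div (continuous_normSq_sub w) fun x => (normSq_sub_pos hw.ne' x).ne'
  have hkp : ∀ x : ℝ, 0 < w.im / Complex.normSq (w - x) := fun x =>
    div_pos hw (normSq_sub_pos hw.ne' x)
  constructor
  · have h1 := hg.integral_signed_pos hab ha hb a b hk.neg (fun x => ?_)
      (fun x hx => absurd hx (neg_ne_zero.2 (hkp x).ne'))
    · simp only [Pi.neg_apply] at h1
      rw [← hg.im_integral_signed a b hw.ne', hg.integral_signed_one_div (by linarith) hw.ne'] at h1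
      simp only [Complex.sub_im, Complex.add_im, Complex.log_im] at h1
      have h2 := arg_lt_pi_of_im_pos (z := w - b) (by simpa using hw)
      have h3 := arg_pos_of_im_pos (z := w - a) (by simpa using hw)
      linarith
    · refine mul_nonneg_of_nonpos_of_nonpos ?_ (neg_nonpos.2 (hkp x).le)
      by_cases hx : x ∈ Set.Icc a b
      · exact hg.signed_nonpos_of_mem hx
      · simp [signedDensity, hx, hg.eq_zero x hx]
  -- The interval `[1, 0]` is empty, so this signed density is `g` itself.
  · have h1 := hg.integral_signed_pos hab ha hb 1 0 hk
      (fun x => mul_nonneg (hg.signed_nonneg_of_notMem (by simp)) (hkp x).le)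
      (fun x hx => absurd hx (hkp x).ne')
    have h2 : cauchyTransform μ w = ∫ x : ℝ, (signedDensity g 1 0 x : ℂ) * (1 / (w - x)) := by
      rw [cauchyTransform, hg.integral_eq]
      simp [signedDensity]
    rw [h2, hg.im_integral_signed 1 0 hw.ne']
    simp only [mul_neg, integral_neg]
    linarith

theorem BoundedDensity.exp_mul_eq_iff {p : ℝ × ℝ} {w : ℂ} (hw : 0 < w.im) :
    Complex.exp (cauchyTransform μ w) * (w - p.1) = w - p.1 - p.2 + 1 ↔
      p.2 ≤ 1 ∧ fDeriv μ p w = 0 := by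
  have h1 : w - p.1 ≠ 0 := sub_ofReal_ne_zero hw.ne' _
  have e : w - p.1 - p.2 + 1 = w - ((p.1 + p.2 - 1 : ℝ) : ℂ) := by
    push_cast
    ring
  have h2 : w - p.1 - p.2 + 1 ≠ 0 := by
    rw [e]
    exact sub_ofReal_ne_zero hw.ne' _
  have hexp : Complex.exp (fDeriv μ p w) =
      Complex.exp (cauchyTransform μ w) * (w - p.1) / (w - p.1 - p.2 + 1) := by
    rw [fDeriv, Complex.exp_sub, Complex.exp_add, Complex.exp_log h1, Complex.exp_log h2]
  constructor
  · intro h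
    have hC := hg.cauchyTransform_im_mem hab ha hb hw
    have hlt := lt_of_exp_mul_eq hC hw (h.trans e)
    have hp : p.2 < 1 := by linarith
    refine ⟨hp.le, ?_⟩
    rw [h, div_self h2, Complex.exp_eq_one_iff] at hexp
    obtain ⟨n, hn⟩ := hexp
    have him : (fDeriv μ p w).im = n * (2 * Real.pi) := by
      rw [hn]
      simp
    have hθ₁ := arg_lt_pi_of_im_pos (z := w - p.1) (by simpa using hw)
    have hθ₂ := arg_pos_of_im_pos (z := w - p.1) (by simpa using hw)
    have hφ₁ := arg_lt_pi_of_im_pos (z := w - p.1 - p.2 + 1) (by simpa using hw)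
    have hφ₂ := arg_pos_of_im_pos (z := w - p.1 - p.2 + 1) (by simpa using hw)
    rw [fDeriv, Complex.sub_im, Complex.add_im, Complex.log_im, Complex.log_im] at him
    have hpi := Real.pi_pos
    have hn1 : (n : ℝ) < 1 := by
      by_contra! hh
      nlinarith [hC.2]
    have hn2 : (-1 : ℝ) ≤ n := by
      by_contra! hh
      have : (n : ℝ) ≤ -2 := by
        have h5 : n < -1 := by exact_mod_cast hh
        have h6 : n ≤ -2 := by omega
        exact_mod_cast h6
      nlinarith [hC.1]
    have hn3 : n < 1 := by exact_mod_cast hn1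
    have hn4 : -1 ≤ n := by exact_mod_cast hn2
    have hn5 : n = 0 ∨ n = -1 := by omega
    rcases hn5 with rfl | rfl
    · simpa using hn
    · exfalso
      -- Hence `Im f' ≥ Im C > -π`, which excludes the value `-2π`.
      have hmono : (w - p.1 - p.2 + 1).arg ≤ (w - p.1).arg := by
        rw [e]
        exact arg_sub_ofReal_le hw hlt.le
      push_cast at him
      linarith [hC.1]
  · rintro ⟨-, h⟩
    rw [h, Complex.exp_zero, eq_div_iff h2, one_mul] at hexp
    exact hexp.symm

end

/-! ### The correspondence between the upper half-plane and the liquid region -/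

section
variable {μ : ProbabilityMeasure ℝ} {a b : ℝ} {g : ℝ → ℝ} (hg : BoundedDensity μ a b g)
  (hab : 1 < b - a) (ha : a ∈ (μ : Measure ℝ).support) (hb : b ∈ (μ : Measure ℝ).support)
include hg hab ha hb

/-- The closed constraints of the shape cost nothing: a root implies them. This is why the liquid
region can be open. -/
theorem BoundedDensity.mem_liquidRegion_of_exp {p : ℝ × ℝ} {w : ℂ} (hw : 0 < w.im)
    (h : Complex.exp (cauchyTransform μ w) * (w - p.1) = w - p.1 - p.2 + 1) :
    p ∈ liquidRegion μ a b := by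
  obtain ⟨hp, hf⟩ := (hg.exp_mul_eq_iff hab ha hb hw).1 h
  have hroot := hf
  rw [hg.fDeriv_eq hp hw.ne'] at hroot
  have h1 := hg.sub_le_one_of_root hab ha hb (by linarith) hw.ne' hroot
  have h2 := hg.le_right_of_root hab ha hb hw.ne' hroot
  have h3 := hg.left_le_of_root hab ha hb hw.ne' hroot
  refine ⟨⟨⟨⟨?_, ?_⟩, ⟨?_, ?_⟩⟩, ?_, ?_, ?_⟩, w, hw.ne', hf⟩ <;> linarith

theorem BoundedDensity.exists_root_of_mem {p : ℝ × ℝ} (hp : p ∈ liquidRegion μ a b) :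
    ∃ w : ℍ, Complex.exp (cauchyTransform μ w) * (w - p.1) = w - p.1 - p.2 + 1 := by
  obtain ⟨hs, w, hw, hf⟩ := hp
  have hp1 : p.2 ≤ 1 := hs.1.2.2
  rcases lt_or_gt_of_ne hw with h | h
  · have hw' : 0 < (conj w).im := by simpa using h
    refine ⟨⟨conj w, hw'⟩, (hg.exp_mul_eq_iff hab ha hb hw').2 ⟨hp1, ?_⟩⟩
    rw [fDeriv_conj μ p hw, hf, map_zero]
  · exact ⟨⟨w, h⟩, (hg.exp_mul_eq_iff hab ha hb h).2 ⟨hp1, hf⟩⟩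

theorem BoundedDensity.exp_root_unique {p : ℝ × ℝ} {w v : ℂ} (hw : 0 < w.im) (hv : 0 < v.im)
    (h : Complex.exp (cauchyTransform μ w) * (w - p.1) = w - p.1 - p.2 + 1)
    (h' : Complex.exp (cauchyTransform μ v) * (v - p.1) = v - p.1 - p.2 + 1) : w = v := by
  obtain ⟨hp, hf⟩ := (hg.exp_mul_eq_iff hab ha hb hw).1 h
  obtain ⟨-, hf'⟩ := (hg.exp_mul_eq_iff hab ha hb hv).1 h'
  rw [hg.fDeriv_eq hp hw.ne'] at hf
  rw [hg.fDeriv_eq hp hv.ne'] at hf'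
  exact hg.root_unique hab ha hb (by linarith) hw hv hf hf'

theorem BoundedDensity.denom_ne_zero {w : ℂ} (hw : 0 < w.im) : denom μ w ≠ 0 := by
  have hC := hg.cauchyTransform_im_mem hab ha hb hw
  intro h
  rw [denom, cauchyTransform_conj, Complex.exp_conj, sub_eq_zero] at h
  have h1 := congrArg Complex.im h
  rw [Complex.conj_im, Complex.exp_im] at h1
  have := mul_neg_of_pos_of_neg (Real.exp_pos (cauchyTransform μ w).re)
    (Real.sin_neg_of_neg_of_neg_pi_lt hC.2 hC.1)
  linarith

theorem BoundedDensity.exp_mul_eq_iff_eq_chiL {p : ℝ × ℝ} {w : ℂ} (hw : 0 < w.im) :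
    Complex.exp (cauchyTransform μ w) * (w - p.1) = w - p.1 - p.2 + 1 ↔
      (p.1 : ℂ) = chiL μ w ∧ (p.2 : ℂ) = etaL μ w := by
  have hd := hg.denom_ne_zero hab ha hb hw
  have hden : denom μ w = Complex.exp (cauchyTransform μ w)
    - Complex.exp (cauchyTransform μ (conj w)) := rfl
  constructor
  · intro h
    have h' : Complex.exp (cauchyTransform μ (conj w)) * (conj w - p.1) =
        conj w - p.1 - p.2 + 1 := by
      have := congrArg conj h
      rw [map_mul, ← Complex.exp_conj, ← cauchyTransform_conj] at this
      simpa using this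
    have h1 : (p.1 : ℂ) = chiL μ w := by
      rw [chiL, ← sub_eq_iff_eq_add', eq_div_iff hd, hden]
      -- Subtracting the equation from its conjugate eliminates `η`.
      linear_combination h' - h
    refine ⟨h1, ?_⟩
    have h2 : (p.2 : ℂ) = 1 + (1 - Complex.exp (cauchyTransform μ w)) * (w - p.1) := by
      linear_combination h
    rw [h2, h1, chiL, etaL]
    field_simp
    ring
  · rintro ⟨h1, h2⟩
    rw [h1, h2, chiL, etaL]
    field_simp
    ring

/-- Conjugation negates `denom`, which makes `chiL` and `etaL` self-conjugate, so their real parts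
solve the equation. -/
theorem BoundedDensity.exists_exp_mul_eq {w : ℂ} (hw : 0 < w.im) : ∃ p : ℝ × ℝ,
    Complex.exp (cauchyTransform μ w) * (w - p.1) = w - p.1 - p.2 + 1 := by
  have hden : conj (denom μ w) = - denom μ w := by
    rw [denom, map_sub, ← Complex.exp_conj, ← Complex.exp_conj, ← cauchyTransform_conj,
      ← cauchyTransform_conj, Complex.conj_conj]
    ring
  have hd := hg.denom_ne_zero hab ha hb hw
  have hE : conj (Complex.exp (cauchyTransform μ w)) =
      Complex.exp (cauchyTransform μ (conj w)) := by
    rw [← Complex.exp_conj, ← cauchyTransform_conj]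
  have hE' : conj (Complex.exp (cauchyTransform μ (conj w))) =
      Complex.exp (cauchyTransform μ w) := by
    rw [← hE, Complex.conj_conj]
  have h1 : conj (chiL μ w) = chiL μ w := by
    rw [chiL, map_add, map_div₀, map_mul, map_sub, map_sub, hden, hE', Complex.conj_conj, map_one]
    have : denom μ w = Complex.exp (cauchyTransform μ w)
      - Complex.exp (cauchyTransform μ (conj w)) := rfl
    field_simp
    rw [this]
    ring
  have h2 : conj (etaL μ w) = etaL μ w := by
    rw [etaL, map_add, map_div₀, map_mul, map_mul, map_sub, map_sub, map_sub, hden, hE, hE',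
      Complex.conj_conj, map_one]
    field_simp
    ring
  refine ⟨((chiL μ w).re, (etaL μ w).re), (hg.exp_mul_eq_iff_eq_chiL hab ha hb hw).2 ⟨?_, ?_⟩⟩
  · exact Complex.conj_eq_iff_re.1 h1
  · exact Complex.conj_eq_iff_re.1 h2

/-- At a root this `w`-derivative of the exponentiated equation equals `(w - c) f''(w)` with `c = χ
+ η - 1`, so simplicity of the root applies. -/
theorem BoundedDensity.deriv_ne_zero {p : ℝ × ℝ} {w : ℂ} (hw : 0 < w.im)
    (h : Complex.exp (cauchyTransform μ w) * (w - p.1) = w - p.1 - p.2 + 1) :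
    Complex.exp (cauchyTransform μ w) * (-∫ x : ℝ, 1 / (w - x) ^ 2 ∂(μ : Measure ℝ)) * (w - p.1)
      + Complex.exp (cauchyTransform μ w) - 1 ≠ 0 := by
  obtain ⟨hp, hf⟩ := (hg.exp_mul_eq_iff hab ha hb hw).1 h
  rw [hg.fDeriv_eq hp hw.ne'] at hf
  have h1 := hg.root_simple hab ha hb (by linarith) hw.ne' hf
  rw [hg.integral_signed (by linarith) (continuous_one_div_sub_sq hw.ne'),
    integral_one_div_sub_sq hw.ne'] at h1
  have hd := sub_ofReal_ne_zero hw.ne' p.1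
  have hc := sub_ofReal_ne_zero hw.ne' (p.1 + p.2 - 1)
  have e : w - p.1 - p.2 + 1 = w - ((p.1 + p.2 - 1 : ℝ) : ℂ) := by
    push_cast
    ring
  rw [e] at h
  generalize ((p.1 + p.2 - 1 : ℝ) : ℂ) = c at *
  intro h0
  apply h1
  have h2 : Complex.exp (cauchyTransform μ w) = (w - c) / (w - p.1) := by
    rw [eq_div_iff hd, h]
  rw [h2] at h0
  generalize ∫ x : ℝ, 1 / (w - x) ^ 2 ∂(μ : Measure ℝ) = I at *
  field_simp at h0 ⊢
  linear_combination -h0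

/-- Nearby parameters have a root near a given one. -/
theorem BoundedDensity.image_mem_nhds {p : ℝ × ℝ} {w : ℂ} (hw : 0 < w.im)
    (h : Complex.exp (cauchyTransform μ w) * (w - p.1) = w - p.1 - p.2 + 1) {U : Set ℂ}
    (hU : U ∈ 𝓝 w) : ∀ᶠ q : ℝ × ℝ in 𝓝 p, ∃ z ∈ U,
      Complex.exp (cauchyTransform μ z) * (z - q.1) = z - q.1 - q.2 + 1 := by
  -- The parameters are complexified so that the implicit function theorem applies over `ℂ`; `φ`
  -- below restricts back to real ones.
  let G : (ℂ × ℂ) × ℂ → ℂ := fun q =>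
    Complex.exp (cauchyTransform μ q.2) * (q.2 - q.1.1) - (q.2 - q.1.1 - q.1.2 + 1)
  let u : (ℂ × ℂ) × ℂ := (((p.1 : ℂ), (p.2 : ℂ)), w)
  have hG : ContDiffAt ℂ 1 G u := by
    have h1 : ContDiffAt ℂ 1 (fun q : (ℂ × ℂ) × ℂ => cauchyTransform μ q.2) u :=
      ContDiffAt.comp (g := cauchyTransform μ) u (contDiffAt_cauchyTransform μ hw.ne') contDiffAt_snd
    have h2 : ContDiffAt ℂ 1 (fun q : (ℂ × ℂ) × ℂ => q.1.1) u :=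
      (contDiff_fst.comp contDiff_fst).contDiffAt
    have h3 : ContDiffAt ℂ 1 (fun q : (ℂ × ℂ) × ℂ => q.1.2) u :=
      (contDiff_snd.comp contDiff_fst).contDiffAt
    exact (h1.cexp.mul (contDiffAt_snd.sub h2)).sub
      (((contDiffAt_snd.sub h2).sub h3).add contDiffAt_const)
  have hs : HasStrictFDerivAt G (fderiv ℂ G u) u := hG.hasStrictFDerivAt one_ne_zero
  set D := Complex.exp (cauchyTransform μ w) *
    (-∫ x : ℝ, 1 / (w - x) ^ 2 ∂(μ : Measure ℝ)) * (w - p.1)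
      + Complex.exp (cauchyTransform μ w) - 1 with hDdef
  have hD : D ≠ 0 := hg.deriv_ne_zero hab ha hb hw h
  have hd1 : HasDerivAt (fun z => G (u.1, z)) D w := by
    have h1 := (hasDerivAt_cauchyTransform μ hw.ne').cexp
    have h2 : HasDerivAt (fun z : ℂ => z - (p.1 : ℂ)) 1 w := (hasDerivAt_id w).sub_const _
    have h3 := (h1.mul h2).sub ((h2.sub_const (p.2 : ℂ)).add_const 1)
    refine h3.congr_deriv ?_
    rw [hDdef]
    ring
  have hd2 : HasDerivAt (fun z => G (u.1, z)) (fderiv ℂ G u (0, 1)) w := by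
    have h1 : HasDerivAt (fun z : ℂ => (u.1, z)) ((0 : ℂ × ℂ), (1 : ℂ)) w :=
      (hasDerivAt_const w u.1).prodMk (hasDerivAt_id w)
    exact hs.hasFDerivAt.comp_hasDerivAt w h1
  have hD' : fderiv ℂ G u (0, 1) = D := hd2.unique hd1
  have hinv : (fderiv ℂ G u ∘L .inr ℂ (ℂ × ℂ) ℂ).IsInvertible := by
    refine ⟨ContinuousLinearEquiv.unitsEquivAut ℂ (Units.mk0 D hD), ?_⟩
    ext
    simp [hD']
  have hG0 : G u = 0 := sub_eq_zero.2 h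
  let φ : ℝ × ℝ → ℂ × ℂ := fun q => ((q.1 : ℂ), (q.2 : ℂ))
  have hφ : Tendsto φ (𝓝 p) (𝓝 u.1) := by
    have : Continuous φ := by fun_prop
    exact this.tendsto p
  have e1 := hφ.eventually (hs.eventually_apply_implicitFunctionOfProdDomain hinv)
  have e2 := hφ.eventually (hs.tendsto_implicitFunctionOfProdDomain hinv hU)
  filter_upwards [e1, e2] with q h1 h2
  refine ⟨_, h2, ?_⟩
  rw [hG0] at h1
  exact sub_eq_zero.1 h1

theorem BoundedDensity.exists_isOpenEmbedding : ∃ Φ : ℍ → ℝ × ℝ, IsOpenEmbedding Φ ∧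
    Set.range Φ = liquidRegion μ a b ∧ ∀ w : ℍ,
      Complex.exp (cauchyTransform μ w) * (w - (Φ w).1) = w - (Φ w).1 - (Φ w).2 + 1 := by
  choose Φ hΦ using fun w : ℍ => hg.exists_exp_mul_eq hab ha hb w.im_pos
  have huniq : ∀ (w : ℍ) (q : ℝ × ℝ),
      Complex.exp (cauchyTransform μ w) * (w - q.1) = w - q.1 - q.2 + 1 → Φ w = q := by
    intro w q hq
    obtain ⟨h1, h2⟩ := (hg.exp_mul_eq_iff_eq_chiL hab ha hb w.im_pos).1 hq
    obtain ⟨h3, h4⟩ := (hg.exp_mul_eq_iff_eq_chiL hab ha hb w.im_pos).1 (hΦ w)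
    exact Prod.ext (Complex.ofReal_injective (h3.trans h1.symm))
      (Complex.ofReal_injective (h4.trans h2.symm))
  have hcC : Continuous fun w : ℍ => cauchyTransform μ w := continuous_iff_continuousAt.2 fun w =>
    ((hasDerivAt_cauchyTransform μ w.im_pos.ne').continuousAt.comp
      UpperHalfPlane.continuous_coe.continuousAt)
  have hcC' : Continuous fun w : ℍ => cauchyTransform μ (conj (w : ℂ)) := by
    simp_rw [cauchyTransform_conj]
    exact Complex.continuous_conj.comp hcC
  have hcw := UpperHalfPlane.continuous_coe
  have hcw' : Continuous fun w : ℍ => conj (w : ℂ) := Complex.continuous_conj.comp hcw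
  have hcd : Continuous fun w : ℍ => denom μ w := hcC.cexp.sub hcC'.cexp
  have hdne : ∀ w : ℍ, denom μ w ≠ 0 := fun w => hg.denom_ne_zero hab ha hb w.im_pos
  have hchi : Continuous fun w : ℍ => chiL μ w :=
    hcw.add (((hcw.sub hcw').mul (hcC'.cexp.sub continuous_const)).div hcd hdne)
  have heta : Continuous fun w : ℍ => etaL μ w :=
    continuous_const.add ((((hcw.sub hcw').mul (hcC.cexp.sub continuous_const)).mul
      (hcC'.cexp.sub continuous_const)).div hcd hdne)
  have hcont : Continuous Φ := by
    have e : Φ = fun w : ℍ => ((chiL μ w).re, (etaL μ w).re) := by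
      funext w
      obtain ⟨h3, h4⟩ := (hg.exp_mul_eq_iff_eq_chiL hab ha hb w.im_pos).1 (hΦ w)
      rw [← h3, ← h4]
      simp
    rw [e]
    exact (Complex.continuous_re.comp hchi).prodMk (Complex.continuous_re.comp heta)
  have hinj : Function.Injective Φ := by
    intro w v hwv
    have h1 := hΦ w
    rw [hwv] at h1
    exact UpperHalfPlane.ext (hg.exp_root_unique hab ha hb w.im_pos v.im_pos h1 (hΦ v))
  have hopen : IsOpenMap Φ := by
    rw [isOpenMap_iff_nhds_le]
    intro w S hS
    -- Each `q` near `Φ w` has a root `z` in this neighbourhood; then `Φ z = q` by `huniq`, so `q ∈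
    -- S`.
    have hU : (fun z : ℍ => (z : ℂ)) '' (Φ ⁻¹' S) ∈ 𝓝 (w : ℂ) :=
      UpperHalfPlane.isOpenEmbedding_coe.image_mem_nhds.2 hS
    filter_upwards [hg.image_mem_nhds hab ha hb w.im_pos (hΦ w) hU]
    rintro q ⟨_, ⟨z, hz, rfl⟩, hq⟩
    rw [← huniq z q hq]
    exact hz
  refine ⟨Φ, .of_continuous_injective_isOpenMap hcont hinj hopen, ?_, hΦ⟩
  ext p
  constructor
  · rintro ⟨w, rfl⟩
    exact hg.mem_liquidRegion_of_exp hab ha hb w.im_pos (hΦ w)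
  · intro hp
    obtain ⟨w, hw⟩ := hg.exists_root_of_mem hab ha hb hp
    exact ⟨w, huniq w p hw⟩

end

end LiquidRegion

theorem theorem2p1 (μ : ProbabilityMeasure ℝ) (a b : ℝ) (x : (n : ℕ) → Fin n → ℤ)
    (h : LiquidRegion.Admissible μ a b x) :
    (∀ p ∈ LiquidRegion.liquidRegion μ a b, ∃! w : ℍ, LiquidRegion.fDeriv μ p (w : ℂ) = 0) ∧
    (∀ w : ℍ, LiquidRegion.denom μ (w : ℂ) ≠ 0) ∧
    (∃ W : LiquidRegion.liquidRegion μ a b ≃ₜ ℍ,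
      (∀ p : LiquidRegion.liquidRegion μ a b,
        LiquidRegion.fDeriv μ (p : ℝ × ℝ) (W p : ℂ) = 0) ∧
      (∀ w : ℍ,
        (((W.symm w : ℝ × ℝ).1 : ℝ) : ℂ) = LiquidRegion.chiL μ (w : ℂ) ∧
        (((W.symm w : ℝ × ℝ).2 : ℝ) : ℂ) = LiquidRegion.etaL μ (w : ℂ))) ∧
    (LiquidRegion.liquidRegion μ a b).Nonempty ∧
    IsOpen (LiquidRegion.liquidRegion μ a b) ∧
    IsConnected (LiquidRegion.liquidRegion μ a b) := by
  obtain ⟨g, hg⟩ := LiquidRegion.exists_boundedDensity h.support_subset h.le_volume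
  have hab := h.one_lt
  have ha := h.left_mem
  have hb := h.right_mem
  obtain ⟨Φ, hΦ, hrange, heq⟩ := hg.exists_isOpenEmbedding hab ha hb
  have hconn : IsConnected (LiquidRegion.liquidRegion μ a b) := hrange ▸ isConnected_range hΦ.continuous
  refine ⟨fun p hp => ?_, fun w => hg.denom_ne_zero hab ha hb w.im_pos, ?_, hconn.nonempty,
    hrange ▸ hΦ.isOpen_range, hconn⟩
  · obtain ⟨w, hw⟩ := hg.exists_root_of_mem hab ha hb hp
    refine ⟨w, ((hg.exp_mul_eq_iff hab ha hb w.im_pos).1 hw).2, fun v hv => ?_⟩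
    exact UpperHalfPlane.ext (hg.exp_root_unique hab ha hb v.im_pos w.im_pos
      ((hg.exp_mul_eq_iff hab ha hb v.im_pos).2 ⟨hp.1.1.2.2, hv⟩) hw)
  · let e : ℍ ≃ₜ LiquidRegion.liquidRegion μ a b :=
      hΦ.isEmbedding.toHomeomorph.trans (Homeomorph.setCongr hrange)
    have he : ∀ w : ℍ, ((e w : LiquidRegion.liquidRegion μ a b) : ℝ × ℝ) = Φ w := fun w => rfl
    refine ⟨e.symm, fun p => ?_, fun w => ?_⟩
    · have h1 := heq (e.symm p)
      rw [← he, e.apply_symm_apply] at h1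
      exact ((hg.exp_mul_eq_iff hab ha hb (e.symm p).im_pos).1 h1).2
    · rw [Homeomorph.symm_symm, he]
      exact (hg.exp_mul_eq_iff_eq_chiL hab ha hb w.im_pos).1 (heq w)
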